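/- Let $A$ be a simple unital C*-algebra, $\Gamma$ a countable discrete group, and $\alpha:\Gamma\to\mathrm{Aut}(A)$ an outer action, i.e. for $g\neq e$ the automorphism $\alpha_g$ is not of the form $a\mapsto uau^*$ with $u\in A$ unitary. Let $B=A\rtimes_{\alpha,r}\Gamma$ be the reduced crossed product (the norm closure of the span of the operators $a u_g$ in the regular representation on $\ell^2(\Gamma,H)$ induced by a faithful unital representation of $A$ on a Hilbert space $H$), with canonical unitaries $u_g$ and canonical conditional expectation $E:B\to A$. Let $\mathcal B$ be the right $A$-$A$ C*-correspondence obtained by completing $B$ with respect to $\langle b_1\mid b_2\rangle_A=E(b_1^*b_2)$, and write $b\Omega$ for the image of $b\in B$ in $\mathcal B$. For $x\in B$ put $\mathrm{supp}(x)=\{g\in\Gamma: E(xu_g^{-1})\neq 0\}$, and for a subspace $X\subseteq B$ put $\mathrm{supp}(X)=\bigcup_{x\in X}\mathrm{supp}(x)$. Call $X$ replete if every $y\in B$ with $\mathrm{supp}(y)\subseteq \mathrm{supp}(X)$ lies in $X$. For a sub-bimodule $\mathcal L\subseteq\mathcal B$ let $\mathrm{supp}(\mathcal L)$ be the set of $g\in\Gamma$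 for which there is a nonzero $A$-$A$ bimodule map ${}_gA\to\mathcal L$, where ${}_gA=A$ with $a\rhd x\lhd c=\alpha_{g^{-1}}(a)xc$. An $A$-$A$ subcorrespondence of $\mathcal B$ is a closed subspace $\mathcal L$ invariant under both actions of $A$; it is orthogonally complemented if $\mathcal B=\mathcal L\oplus\mathcal L^\perp$, where $\mathcal L^\perp=\{\eta\in\mathcal B:\langle\xi\mid\eta\rangle_A=0\ \text{for all}\ \xi\in\mathcal L\}$. Then there is a $*$-isomorphism $\Phi:\ell^\infty(\Gamma)\to\mathrm{End}^\dagger({}_A\mathcal B_A)$ onto the $*$-algebra of adjointable $A$-$A$ bimodule endomorphisms of $\mathcal B$, with $\Phi(f)(au_g\Omega)=f(g)\,au_g\Omega$ for all $f\in\ell^\infty(\Gamma)$, $a\in A$, $g\in\Gamma$, and the assignment $$X\longmapsto \Phi(\mathbb 1_{\mathrm{supp}(X)})[\mathcal B]$$ is a bijection from the set of norm-closed replete $A$-$A$ sub-bimodules $X\subseteq B$ onto the set of orthogonally complemented $A$-$A$ subcorrespondences $\mathcal L\subseteq\mathcal B$, with inverse $$\mathcal L\longmapsto\{b\in B:\mathrm{supp}(b)\subseteq\mathrm{supp}(\mathcal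 L)\}.$$ Moreover, two orthogonally complemented $A$-$A$ subcorrespondences of $\mathcal B$ that are unitarily isomorphic as $A$-$A$ correspondences are equal, so it makes no difference whether they are counted as subspaces of $\mathcal B$ or up to isomorphism. -/

import Mathlib

noncomputable section

open scoped ENNReal InnerProductSpace

namespace RedCrossed

set_option linter.unusedSectionVars false

/-- A (topologically) simple C*-algebra: nonzero, and without closed two-sided ideals other than
the zero ideal and the whole algebra. -/
def IsSimpleCStar (A : Type*) [CStarAlgebra A] : Prop :=
  Nontrivial A ∧ ∀ I : TwoSidedIdeal A, IsClosed (I : Set A) → I = ⊥ ∨ I = ⊤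

/-- An action `α` is outer if `α g` is not of the form `a ↦ u * a * star u`, with `u` a unitary,
for any `g ≠ 1`. -/
def IsOuter {A Γ : Type*} [CStarAlgebra A] [Group Γ] (α : Γ →* (A ≃⋆ₐ[ℂ] A)) : Prop :=
  ∀ g : Γ, g ≠ 1 → ∀ u : unitary A, α g ≠ Unitary.conjStarAlgAut ℂ A u

/-- A faithful (unital) representation of `A` on the Hilbert space `H`. -/
structure FaithfulRep (A H : Type*) [CStarAlgebra A] [NormedAddCommGroup H]
    [InnerProductSpace ℂ H] [CompleteSpace H] where
  hom : A →⋆ₐ[ℂ] (H →L[ℂ] H)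
  injective : Function.Injective hom

variable {A Γ H : Type*} [CStarAlgebra A] [Group Γ]
  [NormedAddCommGroup H] [InnerProductSpace ℂ H] [CompleteSpace H]

variable (Γ H) in
/-- The Hilbert space `ℓ²(Γ, H)`. -/
abbrev L2 : Type _ := lp (fun _ : Γ => H) 2

/-! ### The regular representation -/

/-- The diagonal operator `(D ξ)(g) = T g (ξ g)` of a bounded family of operators. -/
def diagOp (T : Γ → (H →L[ℂ] H)) (C : ℝ) (hC : 0 ≤ C) (hT : ∀ g, ‖T g‖ ≤ C) :
    L2 Γ H →L[ℂ] L2 Γ H :=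
  have key : ∀ (ξ : L2 Γ H) (g : Γ), ‖T g (ξ g)‖ ≤ ‖(((C : ℂ) • ξ : L2 Γ H) : Γ → H) g‖ := by
    intro ξ g
    rw [lp.coeFn_smul, Pi.smul_apply, norm_smul, Complex.norm_real, Real.norm_of_nonneg hC]
    exact (T g).le_of_opNorm_le (hT g) _
  LinearMap.mkContinuous
    { toFun := fun ξ => ⟨fun g => T g (ξ g), (lp.memℓp ((C : ℂ) • ξ)).mono' (key ξ)⟩
      map_add' := fun ξ η => by
        apply lp.ext
        funext g
        exact (T g).map_add (ξ g) (η g)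
      map_smul' := fun c ξ => by
        apply lp.ext
        funext g
        simp }
    C
    (fun ξ => by
      refine (lp.norm_mono (y := (C : ℂ) • ξ) (by norm_num) (key ξ)).trans ?_
      rw [norm_smul, Complex.norm_real, Real.norm_of_nonneg hC])

@[simp] lemma diagOp_apply (T : Γ → (H →L[ℂ] H)) (C : ℝ) (hC : 0 ≤ C) (hT : ∀ g, ‖T g‖ ≤ C)
    (ξ : L2 Γ H) (g : Γ) : diagOp T C hC hT ξ g = T g (ξ g) := rfl

/-- The operator `π̃(a)` on `ℓ²(Γ, H)`, `(π̃(a) ξ)(g) = π(α_{g⁻¹}(a)) ξ(g)`. -/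
def coeffOp (α : Γ →* (A ≃⋆ₐ[ℂ] A)) (π : FaithfulRep A H) (a : A) : L2 Γ H →L[ℂ] L2 Γ H :=
  diagOp (fun g => π.hom (α g⁻¹ a)) ‖a‖ (norm_nonneg a) (fun g => by
    rw [NonUnitalStarAlgHom.norm_map π.hom π.injective, StarAlgEquiv.norm_map])

@[simp] lemma coeffOp_apply (α : Γ →* (A ≃⋆ₐ[ℂ] A)) (π : FaithfulRep A H) (a : A) (ξ : L2 Γ H)
    (g : Γ) : coeffOp α π a ξ g = π.hom (α g⁻¹ a) (ξ g) := rfl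

variable (H) in
/-- The left translation operator `(λ_h ξ)(g) = ξ(h⁻¹ g)` on `ℓ²(Γ, H)`. -/
def transOp (h : Γ) : L2 Γ H →L[ℂ] L2 Γ H :=
  have two : (0 : ℝ) < (2 : ℝ≥0∞).toReal := by norm_num
  LinearMap.mkContinuous
    { toFun := fun ξ => ⟨fun g => ξ (h⁻¹ * g), memℓp_gen
        ((Equiv.mulLeft h⁻¹).summable_iff.2 ((lp.memℓp ξ).summable two))⟩
      map_add' := fun ξ η => by
        apply lp.ext
        funext g
        rfl
      map_smul' := fun c ξ => by
        apply lp.ext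
        funext g
        simp }
    1
    (fun ξ => by
      rw [one_mul]
      refine lp.norm_le_of_tsum_le two (norm_nonneg ξ) ?_
      rw [lp.norm_rpow_eq_tsum two]
      exact ((Equiv.mulLeft h⁻¹).tsum_eq (fun g => ‖ξ g‖ ^ (2 : ℝ≥0∞).toReal)).le)

@[simp] lemma transOp_apply (h : Γ) (ξ : L2 Γ H) (g : Γ) : transOp H h ξ g = ξ (h⁻¹ * g) := rfl

lemma coeffOp_add (α : Γ →* (A ≃⋆ₐ[ℂ] A)) (π : FaithfulRep A H) (a b : A) :
    coeffOp α π (a + b) = coeffOp α π a + coeffOp α π b := by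
  ext ξ g
  simp

lemma coeffOp_smul (α : Γ →* (A ≃⋆ₐ[ℂ] A)) (π : FaithfulRep A H) (c : ℂ) (a : A) :
    coeffOp α π (c • a) = c • coeffOp α π a := by
  ext ξ g
  simp

lemma coeffOp_mul (α : Γ →* (A ≃⋆ₐ[ℂ] A)) (π : FaithfulRep A H) (a b : A) :
    coeffOp α π (a * b) = coeffOp α π a * coeffOp α π b := by
  ext ξ g
  simp

lemma coeffOp_one (α : Γ →* (A ≃⋆ₐ[ℂ] A)) (π : FaithfulRep A H) :
    coeffOp α π 1 = 1 := by
  ext ξ g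
  simp

lemma coeffOp_star (α : Γ →* (A ≃⋆ₐ[ℂ] A)) (π : FaithfulRep A H) (a : A) :
    star (coeffOp α π a) = coeffOp α π (star a) := by
  rw [ContinuousLinearMap.star_eq_adjoint, eq_comm, ContinuousLinearMap.eq_adjoint_iff]
  intro ξ η
  rw [lp.inner_eq_tsum, lp.inner_eq_tsum]
  congr 1
  funext g
  rw [coeffOp_apply, coeffOp_apply, map_star, map_star, ContinuousLinearMap.star_eq_adjoint,
    ContinuousLinearMap.adjoint_inner_left]

lemma transOp_mul (g h : Γ) : transOp H (g * h) = transOp H g * transOp H h := by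
  ext ξ k
  simp [mul_assoc]

lemma transOp_one : transOp H (1 : Γ) = 1 := by
  ext ξ k
  simp

lemma transOp_star (h : Γ) : star (transOp H h) = transOp H h⁻¹ := by
  rw [ContinuousLinearMap.star_eq_adjoint, eq_comm, ContinuousLinearMap.eq_adjoint_iff]
  intro ξ η
  rw [lp.inner_eq_tsum, lp.inner_eq_tsum,
    ← (Equiv.mulLeft h).tsum_eq (fun g => ⟪ξ g, transOp H h η g⟫_ℂ)]
  congr 1
  funext g
  simp

/-- Covariance: `λ_g π̃(a) = π̃(α_g(a)) λ_g`. -/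
lemma transOp_mul_coeffOp (α : Γ →* (A ≃⋆ₐ[ℂ] A)) (π : FaithfulRep A H) (g : Γ) (a : A) :
    transOp H g * coeffOp α π a = coeffOp α π (α g a) * transOp H g := by
  ext ξ k
  simp

/-! ### The reduced crossed product -/

variable (α : Γ →* (A ≃⋆ₐ[ℂ] A)) (π : FaithfulRep A H)

/-- The linear span of the operators `π̃(a) λ_g`. -/
def algSpan : Submodule ℂ (L2 Γ H →L[ℂ] L2 Γ H) :=
  Submodule.span ℂ (Set.range fun p : A × Γ => coeffOp α π p.1 * transOp H p.2)

/-- The algebraic crossed product, as the *-subalgebra of `B(ℓ²(Γ, H))` spanned by the operators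
`π̃(a) λ_g`. -/
def algCrossedProduct : StarSubalgebra ℂ (L2 Γ H →L[ℂ] L2 Γ H) where
  carrier := algSpan α π
  add_mem' := fun hx hy => (algSpan α π).add_mem hx hy
  algebraMap_mem' := fun c => by
    rw [Algebra.algebraMap_eq_smul_one]
    refine (algSpan α π).smul_mem c (Submodule.subset_span ⟨(1, 1), ?_⟩)
    simp only [coeffOp_one, transOp_one, mul_one]
  mul_mem' := fun {x y} hx hy => by
    simp only [SetLike.mem_coe] at hx hy ⊢
    induction hx using Submodule.span_induction with
    | zero => rw [zero_mul]; exact zero_mem _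
    | add u v _ _ hu hv => rw [add_mul]; exact add_mem hu hv
    | smul c u _ hu => rw [smul_mul_assoc]; exact Submodule.smul_mem _ c hu
    | mem u hu =>
      obtain ⟨⟨a, g⟩, rfl⟩ := hu
      induction hy using Submodule.span_induction with
      | zero => rw [mul_zero]; exact zero_mem _
      | add u v _ _ hu hv => rw [mul_add]; exact add_mem hu hv
      | smul c u _ hu => rw [mul_smul_comm]; exact Submodule.smul_mem _ c hu
      | mem v hv =>
        obtain ⟨⟨b, h⟩, rfl⟩ := hv
        refine Submodule.subset_span ⟨(a * α g b, g * h), ?_⟩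
        simp only [coeffOp_mul, transOp_mul]
        rw [mul_assoc, mul_assoc, ← mul_assoc (transOp H g), transOp_mul_coeffOp, mul_assoc]
  star_mem' := fun {x} hx => by
    simp only [SetLike.mem_coe] at hx ⊢
    induction hx using Submodule.span_induction with
    | zero => rw [star_zero]; exact zero_mem _
    | add u v _ _ hu hv => rw [star_add]; exact add_mem hu hv
    | smul c u _ hu => rw [star_smul]; exact Submodule.smul_mem _ _ hu
    | mem u hu =>
      obtain ⟨⟨a, g⟩, rfl⟩ := hu
      refine Submodule.subset_span ⟨(α g⁻¹ (star a), g⁻¹), ?_⟩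
      simp only [star_mul, coeffOp_star, transOp_star, transOp_mul_coeffOp]

/-- The reduced crossed product `B = A ⋊_{α,r} Γ`: the norm closure of the algebraic crossed product
in the regular representation on `ℓ²(Γ, H)` induced by a faithful representation on `H`. -/
def crossedProduct : StarSubalgebra ℂ (L2 Γ H →L[ℂ] L2 Γ H) :=
  (algCrossedProduct α π).topologicalClosure

/-- The embedding `A ⊆ B`. -/
def ofCoeff (a : A) : crossedProduct α π :=
  ⟨coeffOp α π a, subset_closure (Submodule.subset_span ⟨(a, 1), by
    simp only [transOp_one, mul_one]⟩)⟩

/-- The canonical unitaries `u_g ∈ B`. -/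
def groupUnitary (g : Γ) : crossedProduct α π :=
  ⟨transOp H g, subset_closure (Submodule.subset_span ⟨(1, g), by
    simp only [coeffOp_one, one_mul]⟩)⟩

lemma crossedProduct_induction {P : (L2 Γ H →L[ℂ] L2 Γ H) → Prop}
    (hclosed : IsClosed {T | P T}) (hzero : P 0) (hadd : ∀ S T, P S → P T → P (S + T))
    (hsmul : ∀ (c : ℂ) T, P T → P (c • T))
    (hmem : ∀ a g, P (coeffOp α π a * transOp H g)) (b : crossedProduct α π) : P b := by
  have hb : (b : L2 Γ H →L[ℂ] L2 Γ H) ∈ closure (algSpan α π : Set _) := b.2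
  refine hclosed.closure_subset_iff.2 ?_ hb
  intro T hT
  simp only [SetLike.mem_coe] at hT
  induction hT using Submodule.span_induction with
  | zero => exact hzero
  | add u v _ _ hu hv => exact hadd u v hu hv
  | smul c u _ hu => exact hsmul c u hu
  | mem u hu =>
    obtain ⟨⟨a, g⟩, rfl⟩ := hu
    exact hmem a g

/-! ### The conditional expectation -/

variable (Γ H) in
/-- The isometry `V_e : H → ℓ²(Γ, H)` onto the summand indexed by the identity of `Γ`. -/
def inclOne : H →L[ℂ] L2 Γ H :=
  letI := Classical.decEq Γ
  lp.singleContinuousLinearMap ℂ (fun _ : Γ => H) 2 1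

lemma inclOne_apply_one (x : H) : inclOne Γ H x 1 = x := by
  classical
  simp [inclOne]

lemma inclOne_apply_ne (x : H) {g : Γ} (hg : g ≠ 1) : inclOne Γ H x g = 0 := by
  classical
  simp [inclOne, hg]

lemma adjoint_inclOne_apply (ξ : L2 Γ H) : (inclOne Γ H).adjoint ξ = ξ 1 := by
  classical
  refine ext_inner_left ℂ fun x => ?_
  rw [ContinuousLinearMap.adjoint_inner_right]
  simp [inclOne, lp.inner_single_left]

lemma coeffOp_comp_inclOne (a : A) :
    coeffOp α π a ∘L inclOne Γ H = inclOne Γ H ∘L π.hom a := by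
  ext x g
  by_cases hg : g = 1
  · subst hg
    simp [inclOne_apply_one]
  · simp [inclOne_apply_ne _ hg]

/-- The compression `V_e^* T V_e`. -/
def compress (T : L2 Γ H →L[ℂ] L2 Γ H) : H →L[ℂ] H :=
  (inclOne Γ H).adjoint ∘L T ∘L inclOne Γ H

lemma compress_coeffOp (a : A) : compress (coeffOp α π a) = π.hom a := by
  rw [compress, coeffOp_comp_inclOne]
  ext x
  simp [adjoint_inclOne_apply, inclOne_apply_one]

lemma compress_coeffOp_mul_transOp (a : A) {g : Γ} (hg : g ≠ 1) :
    compress (coeffOp α π a * transOp H g) = 0 := by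
  ext x
  simp [compress, adjoint_inclOne_apply, inclOne_apply_ne _ (inv_ne_one.2 hg)]

lemma isClosed_range_hom : IsClosed (Set.range π.hom) :=
  (NonUnitalStarAlgHom.isometry π.hom π.injective).isClosedEmbedding.isClosed_range

lemma continuous_compress :
    Continuous (compress : (L2 Γ H →L[ℂ] L2 Γ H) → (H →L[ℂ] H)) := by
  unfold compress
  fun_prop

lemma exists_hom_eq_compress (b : crossedProduct α π) :
    ∃ a : A, π.hom a = compress (b : L2 Γ H →L[ℂ] L2 Γ H) := by
  refine crossedProduct_induction α π (P := fun T => ∃ a : A, π.hom a = compress T)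
    ((isClosed_range_hom π).preimage continuous_compress) ⟨0, by simp [compress]⟩ ?_ ?_ ?_ b
  · rintro S T ⟨a, ha⟩ ⟨a', ha'⟩
    exact ⟨a + a', by rw [map_add, ha, ha']; simp [compress]⟩
  · rintro c T ⟨a, ha⟩
    exact ⟨c • a, by rw [map_smul, ha]; simp [compress]⟩
  · intro a g
    by_cases hg : g = 1
    · subst hg
      exact ⟨a, by rw [transOp_one, mul_one, compress_coeffOp]⟩
    · exact ⟨0, by rw [compress_coeffOp_mul_transOp α π a hg, map_zero]⟩

/-- The canonical conditional expectation `E : B → A`, determined by `π(E(b)) = V_e^* b V_e`;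
equivalently `E(a u_g) = a` for `g = 1` and `E(a u_g) = 0` for `g ≠ 1`. -/
def condExp (b : crossedProduct α π) : A := (exists_hom_eq_compress α π b).choose

lemma hom_condExp (b : crossedProduct α π) :
    π.hom (condExp α π b) = compress (b : L2 Γ H →L[ℂ] L2 Γ H) :=
  (exists_hom_eq_compress α π b).choose_spec

lemma condExp_ofCoeff (a : A) : condExp α π (ofCoeff α π a) = a := by
  apply π.injective
  rw [hom_condExp]
  exact compress_coeffOp α π a

lemma condExp_ofCoeff_mul_groupUnitary (a : A) {g : Γ} (hg : g ≠ 1) :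
    condExp α π (ofCoeff α π a * groupUnitary α π g) = 0 := by
  apply π.injective
  rw [hom_condExp, map_zero]
  exact compress_coeffOp_mul_transOp α π a hg

/-! ### Supports and replete bimodules -/

/-- The support `{g | E(x u_g⁻¹) ≠ 0}` of an element of `B`. -/
def supp (x : crossedProduct α π) : Set Γ :=
  {g | condExp α π (x * groupUnitary α π g⁻¹) ≠ 0}

/-- The support of a subspace of `B`. -/
def suppSubspace (X : Submodule ℂ (crossedProduct α π)) : Set Γ :=
  ⋃ x ∈ X, supp α π x

/-- Norm-closed replete `A`-`A` sub-bimodules of `B`. -/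
structure IsRepleteBimodule (X : Submodule ℂ (crossedProduct α π)) : Prop where
  left_mem : ∀ (a : A), ∀ x ∈ X, ofCoeff α π a * x ∈ X
  right_mem : ∀ (a : A), ∀ x ∈ X, x * ofCoeff α π a ∈ X
  isClosed : IsClosed (X : Set (crossedProduct α π))
  replete : ∀ y, supp α π y ⊆ suppSubspace α π X → y ∈ X

/-! ### The correspondence `ℬ`

The completion of `B` for the `A`-valued inner product `⟨b₁ | b₂⟩ = E(b₁^* b₂)` is realized inside
`B(H, ℓ²(Γ, H))`: since `π(E(b₁^* b₂)) = (b₁ V_e)^* (b₂ V_e)`, the map `b ↦ b V_e` is isometric for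
the norm `‖E(b^* b)‖^{1/2}`, and `ℬ` is the closure of its range. -/

/-- The range of `b ↦ b V_e`. -/
def preCorr : Submodule ℂ (H →L[ℂ] L2 Γ H) where
  carrier := Set.range fun b : crossedProduct α π =>
    (b : L2 Γ H →L[ℂ] L2 Γ H) ∘L inclOne Γ H
  add_mem' := by
    rintro _ _ ⟨b, rfl⟩ ⟨c, rfl⟩
    exact ⟨b + c, by simp⟩
  zero_mem' := ⟨0, by simp⟩
  smul_mem' := by
    rintro c _ ⟨b, rfl⟩
    exact ⟨c • b, by simp⟩

/-- The right C*-correspondence `ℬ`, the completion of `B` with respect to `E`. -/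
abbrev Corr : Type _ := (preCorr α π).topologicalClosure

instance : CompleteSpace (Corr α π) :=
  (preCorr α π).isClosed_topologicalClosure.completeSpace_coe

/-- The canonical map `B → ℬ`, `b ↦ bΩ`. -/
def toCorr (b : crossedProduct α π) : Corr α π :=
  ⟨(b : L2 Γ H →L[ℂ] L2 Γ H) ∘L inclOne Γ H, subset_closure ⟨b, rfl⟩⟩

lemma denseRange_toCorr : DenseRange (toCorr α π) := by
  intro ξ
  rw [closure_subtype]
  refine closure_mono ?_ ξ.2
  rintro _ ⟨b, rfl⟩
  exact ⟨toCorr α π b, ⟨b, rfl⟩, rfl⟩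

lemma Corr.induction {P : (H →L[ℂ] L2 Γ H) → Prop} (hclosed : IsClosed {T | P T})
    (hmem : ∀ b : crossedProduct α π, P ((b : L2 Γ H →L[ℂ] L2 Γ H) ∘L inclOne Γ H))
    (ξ : Corr α π) : P ξ := by
  refine hclosed.closure_subset_iff.2 ?_ ξ.2
  rintro _ ⟨b, rfl⟩
  exact hmem b

lemma adjoint_comp_eq_compress (b c : crossedProduct α π) :
    ((b : L2 Γ H →L[ℂ] L2 Γ H) ∘L inclOne Γ H).adjoint ∘L
        ((c : L2 Γ H →L[ℂ] L2 Γ H) ∘L inclOne Γ H) =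
      compress ((star b * c : crossedProduct α π) : L2 Γ H →L[ℂ] L2 Γ H) := by
  rw [ContinuousLinearMap.adjoint_comp]
  rfl

lemma exists_hom_eq_inner (ξ η : Corr α π) :
    ∃ a : A, π.hom a = (ξ : H →L[ℂ] L2 Γ H).adjoint ∘L (η : H →L[ℂ] L2 Γ H) := by
  refine Corr.induction α π
    (P := fun S => ∃ a : A, π.hom a = S.adjoint ∘L (η : H →L[ℂ] L2 Γ H)) ?_ (fun b => ?_) ξ
  · refine (isClosed_range_hom π).preimage (f := fun S : H →L[ℂ] L2 Γ H =>
      S.adjoint ∘L (η : H →L[ℂ] L2 Γ H)) ?_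
    exact (ContinuousLinearMap.adjoint.continuous).clm_comp continuous_const
  · refine Corr.induction α π (P := fun T => ∃ a : A, π.hom a =
      ((b : L2 Γ H →L[ℂ] L2 Γ H) ∘L inclOne Γ H).adjoint ∘L T) ?_ (fun c => ?_) η
    · exact (isClosed_range_hom π).preimage (f := fun T : H →L[ℂ] L2 Γ H =>
        ((b : L2 Γ H →L[ℂ] L2 Γ H) ∘L inclOne Γ H).adjoint ∘L T) (by fun_prop)
    · exact ⟨condExp α π (star b * c), by rw [hom_condExp, adjoint_comp_eq_compress]⟩

/-- The `A`-valued inner product of `ℬ`, determined by `π(⟨ξ | η⟩) = ξ^* η`. -/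
def corrInner (ξ η : Corr α π) : A := (exists_hom_eq_inner α π ξ η).choose

lemma hom_corrInner (ξ η : Corr α π) :
    π.hom (corrInner α π ξ η) = (ξ : H →L[ℂ] L2 Γ H).adjoint ∘L (η : H →L[ℂ] L2 Γ H) :=
  (exists_hom_eq_inner α π ξ η).choose_spec

lemma corrInner_toCorr (b c : crossedProduct α π) :
    corrInner α π (toCorr α π b) (toCorr α π c) = condExp α π (star b * c) := by
  apply π.injective
  rw [hom_corrInner, hom_condExp, ← adjoint_comp_eq_compress]
  rfl

lemma norm_sq_corr (ξ : Corr α π) : ‖ξ‖ ^ 2 = ‖corrInner α π ξ ξ‖ := by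
  rw [← NonUnitalStarAlgHom.norm_map π.hom π.injective, hom_corrInner,
    ContinuousLinearMap.norm_adjoint_comp_self, pow_two]
  rfl

lemma corrInner_star (ξ η : Corr α π) :
    star (corrInner α π ξ η) = corrInner α π η ξ := by
  apply π.injective
  rw [map_star, hom_corrInner, hom_corrInner, ContinuousLinearMap.star_eq_adjoint,
    ContinuousLinearMap.adjoint_comp, ContinuousLinearMap.adjoint_adjoint]

lemma corrInner_sub_right (ξ η ζ : Corr α π) :
    corrInner α π ξ (η - ζ) = corrInner α π ξ η - corrInner α π ξ ζ := by
  apply π.injective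
  rw [map_sub, hom_corrInner, hom_corrInner, hom_corrInner]
  ext x
  simp

lemma corr_ext {η ζ : Corr α π} (h : ∀ ξ, corrInner α π ξ η = corrInner α π ξ ζ) : η = ζ := by
  have h0 : corrInner α π (η - ζ) (η - ζ) = 0 := by
    rw [corrInner_sub_right, h, sub_self]
  have h1 := norm_sq_corr α π (η - ζ)
  rw [h0, norm_zero, sq_eq_zero_iff] at h1
  exact sub_eq_zero.1 (norm_eq_zero.1 h1)

/-- The left action `a ▷ ξ` of `A` on `ℬ`, extending `a ▷ bΩ = (ab)Ω`. -/
def lact (a : A) (ξ : Corr α π) : Corr α π :=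
  ⟨coeffOp α π a ∘L (ξ : H →L[ℂ] L2 Γ H), by
    refine Corr.induction α π (P := fun S => coeffOp α π a ∘L S ∈ (preCorr α π).topologicalClosure)
      ?_ (fun b => ?_) ξ
    · exact (preCorr α π).isClosed_topologicalClosure.preimage
        (f := fun S : H →L[ℂ] L2 Γ H => coeffOp α π a ∘L S) (by fun_prop)
    · exact subset_closure ⟨ofCoeff α π a * b, rfl⟩⟩

/-- The right action `ξ ◁ a` of `A` on `ℬ`, extending `bΩ ◁ a = (ba)Ω`. -/
def ract (ξ : Corr α π) (a : A) : Corr α π :=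
  ⟨(ξ : H →L[ℂ] L2 Γ H) ∘L π.hom a, by
    refine Corr.induction α π (P := fun S => S ∘L π.hom a ∈ (preCorr α π).topologicalClosure)
      ?_ (fun b => ?_) ξ
    · exact (preCorr α π).isClosed_topologicalClosure.preimage
        (f := fun S : H →L[ℂ] L2 Γ H => S ∘L π.hom a) (by fun_prop)
    · refine subset_closure ⟨b * ofCoeff α π a, ?_⟩
      change (b : L2 Γ H →L[ℂ] L2 Γ H) ∘L (coeffOp α π a ∘L inclOne Γ H) = _
      rw [coeffOp_comp_inclOne]
      rfl⟩

lemma lact_toCorr (a : A) (b : crossedProduct α π) :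
    lact α π a (toCorr α π b) = toCorr α π (ofCoeff α π a * b) := rfl

lemma ract_toCorr (b : crossedProduct α π) (a : A) :
    ract α π (toCorr α π b) a = toCorr α π (b * ofCoeff α π a) := by
  apply Subtype.ext
  change (b : L2 Γ H →L[ℂ] L2 Γ H) ∘L (inclOne Γ H ∘L π.hom a) = _
  rw [← coeffOp_comp_inclOne]
  rfl

lemma corrInner_ract (ξ η : Corr α π) (a : A) :
    corrInner α π ξ (ract α π η a) = corrInner α π ξ η * a := by
  apply π.injective
  rw [map_mul, hom_corrInner, hom_corrInner]
  rfl

lemma corrInner_lact (ξ η : Corr α π) (a : A) :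
    corrInner α π (lact α π a ξ) η = corrInner α π ξ (lact α π (star a) η) := by
  apply π.injective
  rw [hom_corrInner, hom_corrInner]
  change (coeffOp α π a ∘L (ξ : H →L[ℂ] L2 Γ H)).adjoint ∘L (η : H →L[ℂ] L2 Γ H) =
    (ξ : H →L[ℂ] L2 Γ H).adjoint ∘L (coeffOp α π (star a) ∘L (η : H →L[ℂ] L2 Γ H))
  rw [ContinuousLinearMap.adjoint_comp, ← coeffOp_star]
  rfl

/-! ### Adjointable bimodule endomorphisms -/

/-- `S` is an adjoint of `T` for the `A`-valued inner product. -/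
def IsAdjointPair (T S : Corr α π →L[ℂ] Corr α π) : Prop :=
  ∀ ξ η, corrInner α π (T ξ) η = corrInner α π ξ (S η)

variable {α π} in
lemma IsAdjointPair.symm {T S : Corr α π →L[ℂ] Corr α π} (h : IsAdjointPair α π T S) :
    IsAdjointPair α π S T := fun ξ η => by
  rw [← corrInner_star, ← h, corrInner_star]

lemma corrInner_add_right (ξ η ζ : Corr α π) :
    corrInner α π ξ (η + ζ) = corrInner α π ξ η + corrInner α π ξ ζ := by
  apply π.injective
  rw [map_add, hom_corrInner, hom_corrInner, hom_corrInner]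
  ext x
  simp

lemma corrInner_smul_right (c : ℂ) (ξ η : Corr α π) :
    corrInner α π ξ (c • η) = c • corrInner α π ξ η := by
  apply π.injective
  rw [map_smul, hom_corrInner, hom_corrInner]
  ext x
  simp

lemma lact_add (a : A) (ξ η : Corr α π) :
    lact α π a (ξ + η) = lact α π a ξ + lact α π a η := by
  apply Subtype.ext
  simp [lact]

lemma lact_smul (a : A) (c : ℂ) (ξ : Corr α π) :
    lact α π a (c • ξ) = c • lact α π a ξ := by
  apply Subtype.ext
  simp [lact]

lemma ract_add (a : A) (ξ η : Corr α π) :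
    ract α π (ξ + η) a = ract α π ξ a + ract α π η a := by
  apply Subtype.ext
  simp [ract]

lemma ract_smul (a : A) (c : ℂ) (ξ : Corr α π) :
    ract α π (c • ξ) a = c • ract α π ξ a := by
  apply Subtype.ext
  simp [ract]

/-- `End†(_Aℬ_A)`: the algebra of adjointable `A`-`A` bimodule endomorphisms of `ℬ`. -/
def EndAA : Subalgebra ℂ (Corr α π →L[ℂ] Corr α π) where
  carrier := {T | (∀ a ξ, T (lact α π a ξ) = lact α π a (T ξ)) ∧
    (∀ ξ a, T (ract α π ξ a) = ract α π (T ξ) a) ∧ ∃ S, IsAdjointPair α π T S}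
  mul_mem' := by
    rintro T T' ⟨h1, h2, S, hS⟩ ⟨h1', h2', S', hS'⟩
    refine ⟨fun a ξ => ?_, fun ξ a => ?_, S' * S, fun ξ η => ?_⟩
    · change T (T' _) = lact α π a (T (T' ξ))
      rw [h1', h1]
    · change T (T' _) = ract α π (T (T' ξ)) a
      rw [h2', h2]
    · change corrInner α π (T (T' ξ)) η = corrInner α π ξ (S' (S η))
      rw [hS, hS']
  add_mem' := by
    rintro T T' ⟨h1, h2, S, hS⟩ ⟨h1', h2', S', hS'⟩
    refine ⟨fun a ξ => ?_, fun ξ a => ?_, S + S', fun ξ η => ?_⟩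
    · simp only [_root_.add_apply, h1, h1', lact_add]
    · simp only [_root_.add_apply, h2, h2', ract_add]
    · simp only [_root_.add_apply]
      rw [corrInner_add_right, ← hS, ← hS', ← corrInner_star, corrInner_add_right, star_add,
        corrInner_star, corrInner_star]
  algebraMap_mem' := by
    intro c
    refine ⟨fun a ξ => (lact_smul α π a c ξ).symm, fun ξ a => (ract_smul α π a c ξ).symm,
      star c • (1 : Corr α π →L[ℂ] Corr α π), fun ξ η => ?_⟩
    · change corrInner α π (c • ξ) η = corrInner α π ξ (star c • η)
      rw [corrInner_smul_right, ← corrInner_star, corrInner_smul_right, star_smul, corrInner_star]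

lemma exists_adjoint_mem (T : EndAA α π) :
    ∃ S : EndAA α π, IsAdjointPair α π (T : Corr α π →L[ℂ] Corr α π) S := by
  obtain ⟨T, h1, h2, S, hS⟩ := T
  refine ⟨⟨S, fun a ξ => ?_, fun ξ a => ?_, T, hS.symm⟩, hS⟩
  · refine corr_ext α π fun η => ?_
    rw [← hS, ← star_star a, ← corrInner_lact, ← corrInner_lact, ← h1, hS]
  · refine corr_ext α π fun η => ?_
    rw [← hS, corrInner_ract, corrInner_ract, hS]

/-- The involution of `End†(_Aℬ_A)`: the adjoint. -/
instance : Star (EndAA α π) := ⟨fun T => (exists_adjoint_mem α π T).choose⟩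

lemma isAdjointPair_star (T : EndAA α π) :
    IsAdjointPair α π (T : Corr α π →L[ℂ] Corr α π) (star T : EndAA α π) :=
  (exists_adjoint_mem α π T).choose_spec

/-! ### Complemented subcorrespondences -/

/-- The orthogonal complement `L^⊥` in `ℬ`. -/
def orthCompl (L : Submodule ℂ (Corr α π)) : Set (Corr α π) :=
  {η | ∀ ξ ∈ L, corrInner α π ξ η = 0}

/-- Orthogonally complemented `A`-`A` subcorrespondences of `ℬ`. -/
structure IsComplementedSubcorr (L : Submodule ℂ (Corr α π)) : Prop where
  left_mem : ∀ (a : A), ∀ ξ ∈ L, lact α π a ξ ∈ L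
  right_mem : ∀ (a : A), ∀ ξ ∈ L, ract α π ξ a ∈ L
  isClosed : IsClosed (L : Set (Corr α π))
  decomp : ∀ ξ, ∃ η ∈ L, ∃ ζ ∈ orthCompl α π L, ξ = η + ζ

/-- The support of a subcorrespondence: those `g` for which there is a nonzero `A`-`A` bimodule map
from `_gA` to it, where `_gA` is `A` with the bimodule structure `a ▷ x ◁ c = α_{g⁻¹}(a) x c`. -/
def corrSupp (L : Submodule ℂ (Corr α π)) : Set Γ :=
  {g | ∃ T : A →ₗ[ℂ] Corr α π, T ≠ 0 ∧ (∀ x, T x ∈ L) ∧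
    ∀ a x c, T (α g⁻¹ a * x * c) = ract α π (lact α π a (T x)) c}

/-- Unitary isomorphism of `A`-`A` correspondences, for sub-bimodules of `ℬ`. -/
def SubcorrIso (L M : Submodule ℂ (Corr α π)) : Prop :=
  ∃ U : L ≃ₗ[ℂ] M,
    (∀ ξ η : L, corrInner α π (U ξ : Corr α π) (U η : Corr α π) = corrInner α π ξ η) ∧
    (∀ (a : A) (ξ η : L), (η : Corr α π) = lact α π a ξ →
      (U η : Corr α π) = lact α π a (U ξ : Corr α π)) ∧
    (∀ (a : A) (ξ η : L), (η : Corr α π) = ract α π ξ a →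
      (U η : Corr α π) = ract α π (U ξ : Corr α π) a)

variable (Γ) in
/-- The algebra `ℓ^∞(Γ)`. -/
abbrev LInfty : Type _ := lp (fun _ : Γ => ℂ) ∞

/-- The indicator function `1_S ∈ ℓ^∞(Γ)`. -/
def indicatorFn (S : Set Γ) : LInfty Γ :=
  ⟨S.indicator 1, memℓp_infty ⟨1, by
    rintro _ ⟨g, rfl⟩
    by_cases hg : g ∈ S <;> simp [hg]⟩⟩

end RedCrossed

end

/-!
The correspondence `ℬ` is a Hilbert `A`-module with orthonormal basis `u_g Ω`, on which `A` acts
from the left by `a ▷ u_g Ω = u_g Ω ◁ α_{g⁻¹}(a)`. Everything reduces to one fact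
(`exists_eq_smul_unitVec`): a vector `ξ` of `ℬ` satisfying `a ▷ ξ = ξ ◁ α_{g⁻¹}(a)` for all `a` is a
scalar multiple of `u_g Ω`. Its coordinates `c_h = ⟨u_h Ω | ξ⟩` satisfy
`α_{h⁻¹}(a) c_h = c_h α_{g⁻¹}(a)`. In a simple C*-algebra the centre is trivial
(`IsSimpleCStar.exists_eq_algebraMap`), so `c_g` is a scalar, and a nonzero `c_h` with `h ≠ g` would
be a multiple of a unitary implementing `α (h⁻¹ g)` (`IsSimpleCStar.exists_unitary_of_intertwine`),
contrary to outerness.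

A bimodule endomorphism preserves this intertwining relation, so it acts on `u_g Ω` by a scalar
`f g`, and boundedness of the endomorphism bounds `f`; conversely each bounded `f` acts diagonally.
This is the isomorphism `Φ`.

Both sides of the correspondence are in bijection with the subsets of `Γ`. A replete bimodule is by
definition the set of all elements supported in its support, and every subset is such a support,
since `u_g` has support `{g}`. If `L` is a complemented subcorrespondence, then the two components
of `u_g Ω` in `L` and `L^⊥` are again intertwining, hence multiples of `u_g Ω`, and so one of them
vanishes: each `u_g Ω` lies in `L` or in `L^⊥`. Hence `L` is the range of the diagonal projection
onto `{g | u_g Ω ∈ L}` (`IsComplementedSubcorr.eq_suppCorr`), and this set is the support of `L`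
because a bimodule map `_gA → L` is given by an intertwining vector. In the same way a bimodule
isomorphism sends `u_g Ω` to a multiple of itself, so isomorphic subcorrespondences coincide.
-/

noncomputable section

open scoped ENNReal InnerProductSpace

namespace RedCrossed

set_option linter.unusedSectionVars false

/-! ### Twisted-central elements of a simple C*-algebra -/

section Simple

variable {A : Type*} [CStarAlgebra A]

/-- The closed ideal generated by a non-invertible central element is proper, because the units are
open; in a simple algebra the element therefore vanishes. Applied to `z - c` with `c` in the
spectrum of `z`, this shows that the centre is trivial. -/
lemma IsSimpleCStar.exists_eq_algebraMap (hA : IsSimpleCStar A) {z : A}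
    (hz : ∀ a, a * z = z * a) : ∃ c : ℂ, z = algebraMap ℂ A c := by
  obtain ⟨hnt, hI⟩ := hA
  obtain ⟨c, hc⟩ := spectrum.nonempty z
  refine ⟨c, ?_⟩
  set w := algebraMap ℂ A c - z with hw
  have hwc : ∀ a, a * w = w * a := fun a => by
    rw [hw, mul_sub, sub_mul, hz, Algebra.commutes]
  have hwu : ¬ IsUnit w := hc
  -- `S` is the closed ideal generated by `w`.
  let S : Set A := closure (Set.range fun a => w * a)
  have hadd : ∀ {x y}, x ∈ S → y ∈ S → x + y ∈ S := fun {x y} hx hy =>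
    map_mem_closure₂ continuous_add hx hy (by
      rintro _ ⟨a, rfl⟩ _ ⟨b, rfl⟩
      exact ⟨a + b, mul_add _ _ _⟩)
  have hneg : ∀ {x}, x ∈ S → -x ∈ S := fun {x} hx =>
    map_mem_closure continuous_neg hx (by
      rintro _ ⟨a, rfl⟩
      exact ⟨-a, mul_neg _ _⟩)
  have hleft : ∀ {x y}, y ∈ S → x * y ∈ S := fun {x y} hy =>
    map_mem_closure (continuous_const_mul x) hy (by
      rintro _ ⟨a, rfl⟩
      exact ⟨x * a, by simp only [← mul_assoc, hwc]⟩)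
  have hright : ∀ {x y}, x ∈ S → x * y ∈ S := fun {x y} hx =>
    map_mem_closure (f := fun v => v * y) (continuous_mul_const y) hx (by
      rintro _ ⟨a, rfl⟩
      exact ⟨a * y, (mul_assoc _ _ _).symm⟩)
  have hzero : (0 : A) ∈ S := subset_closure ⟨0, mul_zero _⟩
  let I : TwoSidedIdeal A := .mk' S hzero hadd hneg hleft hright
  have hmem : ∀ x, x ∈ I ↔ x ∈ S := fun x => TwoSidedIdeal.mem_mk' ..
  rcases hI I ((Set.ext hmem : (I : Set A) = S) ▸ isClosed_closure) with h | h
  · have : w ∈ I := (hmem w).2 (subset_closure ⟨1, mul_one _⟩)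
    rw [h, TwoSidedIdeal.mem_bot] at this
    exact (sub_eq_zero.1 this).symm
  · have h1 : (1 : A) ∈ S := (hmem 1).1 (h ▸ TwoSidedIdeal.mem_top A)
    -- The open set of units around `1` meets `w A`.
    obtain ⟨_, hu, a, rfl⟩ := mem_closure_iff.1 h1 _ Units.isOpen isUnit_one
    exact absurd (((show Commute w a from (hwc a).symm).isUnit_mul_iff).1 hu).1 hwu

/-- If `t` intertwines the identity with an automorphism `σ`, then `star t * t` and `t * star t` are
central, hence scalar, so that a nonzero `t` is a multiple of a unitary implementing `σ`. -/
lemma IsSimpleCStar.exists_unitary_of_intertwine (hA : IsSimpleCStar A) (σ : A ≃⋆ₐ[ℂ] A) {t : A}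
    (ht : t ≠ 0) (h : ∀ a, σ a * t = t * a) :
    ∃ u : unitary A, σ = Unitary.conjStarAlgAut ℂ A u := by
  have := hA.1
  have h' : ∀ a, star t * σ a = a * star t := fun a => by
    have := congrArg star (h (star a))
    simpa [map_star] using this
  obtain ⟨c, hc⟩ := hA.exists_eq_algebraMap (z := star t * t) fun a => by
    rw [mul_assoc, ← h, ← mul_assoc, ← mul_assoc, h']
  obtain ⟨d, hd⟩ := hA.exists_eq_algebraMap (z := t * star t) fun a => by
    obtain ⟨b, rfl⟩ := EquivLike.surjective σ a
    rw [mul_assoc, h', ← mul_assoc, ← mul_assoc, h]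
  have hc0 : c ≠ 0 := by
    rintro rfl
    rw [map_zero] at hc
    exact ht (CStarRing.star_mul_self_eq_zero_iff t |>.1 hc)
  have hcd : c = d := by
    -- Compare the two ways of bracketing `t * star t * t`.
    have h1 : t * (star t * t) = (t * star t) * t := (mul_assoc _ _ _).symm
    rw [hc, hd, ← Algebra.commutes, ← sub_eq_zero, ← sub_mul, ← map_sub,
      ← Algebra.smul_def, smul_eq_zero] at h1
    exact sub_eq_zero.1 (h1.resolve_right ht)
  have hs : star c = c := by
    have h1 := congrArg star hc
    rw [star_mul, star_star, hc, ← algebraMap_star_comm] at h1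
    exact ((algebraMap ℂ A).injective h1).symm
  have hcr : ((c.re : ℝ) : ℂ) = c := Complex.conj_eq_iff_re.1 hs
  have hpos : 0 < c.re := by
    refine lt_of_le_of_ne (spectrum_star_mul_self_nonneg (b := t) c.re ?_) fun h0 => hc0 ?_
    · rw [hc, ← hcr, ← Complex.coe_algebraMap, ← IsScalarTower.algebraMap_apply,
        Complex.coe_algebraMap, Complex.ofReal_re, spectrum.scalar_eq]
      exact Set.mem_singleton _
    · rw [← hcr, ← h0, Complex.ofReal_zero]
  -- `star t * t = c`, so `c ^ (-1/2) • t` is unitary.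
  set r : ℂ := (((Real.sqrt c.re)⁻¹ : ℝ) : ℂ) with hr
  have hrs : star r = r := Complex.conj_ofReal _
  have hrc : r * r * c = 1 := by
    rw [← hcr, hr]
    norm_cast
    rw [← mul_inv, Real.mul_self_sqrt hpos.le, inv_mul_cancel₀ hpos.ne']
  have hu : r • t ∈ unitary A := by
    rw [Unitary.mem_iff]
    simp only [star_smul, hrs, smul_mul_smul_comm, hc, hd, ← hcd]
    rw [Algebra.smul_def, ← map_mul, hrc, map_one]
    exact ⟨rfl, rfl⟩
  refine ⟨⟨r • t, hu⟩, StarAlgEquiv.ext fun a => ?_⟩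
  rw [Unitary.conjStarAlgAut_apply]
  change σ a = (r • t) * a * star (r • t)
  rw [mul_assoc, ← mul_one (σ a), ← hu.2]
  simp only [← mul_assoc, mul_smul_comm, smul_mul_assoc, h]

end Simple
variable {A Γ H : Type*} [CStarAlgebra A] [Group Γ]
  [NormedAddCommGroup H] [InnerProductSpace ℂ H] [CompleteSpace H]
variable (α : Γ →* (A ≃⋆ₐ[ℂ] A)) (π : FaithfulRep A H)

/-! ### The conditional expectation on monomials -/

lemma groupUnitary_mul (g h : Γ) :
    groupUnitary α π (g * h) = groupUnitary α π g * groupUnitary α π h :=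
  Subtype.ext (transOp_mul g h)

lemma groupUnitary_one : groupUnitary α π 1 = 1 := Subtype.ext transOp_one

lemma star_groupUnitary (g : Γ) : star (groupUnitary α π g) = groupUnitary α π g⁻¹ :=
  Subtype.ext (transOp_star g)

lemma ofCoeff_one : ofCoeff α π 1 = 1 := Subtype.ext (coeffOp_one α π)

lemma ofCoeff_mul (a b : A) : ofCoeff α π (a * b) = ofCoeff α π a * ofCoeff α π b :=
  Subtype.ext (coeffOp_mul α π a b)

lemma groupUnitary_mul_ofCoeff (g : Γ) (a : A) :
    groupUnitary α π g * ofCoeff α π a = ofCoeff α π (α g a) * groupUnitary α π g :=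
  Subtype.ext (transOp_mul_coeffOp α π g a)

lemma ofCoeff_mul_groupUnitary (g : Γ) (a : A) :
    ofCoeff α π a * groupUnitary α π g = groupUnitary α π g * ofCoeff α π (α g⁻¹ a) := by
  rw [groupUnitary_mul_ofCoeff, ← StarAlgEquiv.mul_apply, ← map_mul]
  simp

lemma condExp_ofCoeff_mul (a : A) (b : crossedProduct α π) :
    condExp α π (ofCoeff α π a * b) = a * condExp α π b := by
  apply π.injective
  rw [map_mul, hom_condExp, hom_condExp]
  ext x
  simp [compress, adjoint_inclOne_apply, ofCoeff]

lemma condExp_mul_ofCoeff (b : crossedProduct α π) (a : A) :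
    condExp α π (b * ofCoeff α π a) = condExp α π b * a := by
  apply π.injective
  rw [map_mul, hom_condExp, hom_condExp]
  change compress ((b : L2 Γ H →L[ℂ] L2 Γ H) ∘L coeffOp α π a) = _
  rw [compress, ContinuousLinearMap.comp_assoc, coeffOp_comp_inclOne]
  rfl

lemma continuous_condExp : Continuous (condExp α π) := by
  rw [(NonUnitalStarAlgHom.isometry π.hom π.injective).isEmbedding.continuous_iff]
  exact (continuous_compress.comp continuous_subtype_val).congr fun b => (hom_condExp α π b).symm

lemma condExp_zero : condExp α π 0 = 0 := by
  simpa [← ofCoeff_mul] using condExp_ofCoeff_mul α π 0 0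

/-! ### Replete bimodules and subsets of the group -/

lemma supp_groupUnitary [Nontrivial A] (g : Γ) : supp α π (groupUnitary α π g) = {g} := by
  ext h
  rw [supp, Set.mem_ofPred_eq, ← groupUnitary_mul, Set.mem_singleton_iff]
  by_cases hgh : h = g
  · subst hgh
    rw [mul_inv_cancel, groupUnitary_one, ← ofCoeff_one, condExp_ofCoeff]
    simp
  · have hne : g * h⁻¹ ≠ 1 := fun h1 => hgh (mul_inv_eq_one.1 h1).symm
    have := condExp_ofCoeff_mul_groupUnitary α π 1 hne
    rw [ofCoeff_one, one_mul] at this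
    simp [this, hgh]

/-- The bimodule of all elements of the crossed product that are supported in `S`. -/
def suppBimodule (S : Set Γ) : Submodule ℂ (crossedProduct α π) where
  carrier := {b | supp α π b ⊆ S}
  zero_mem' := fun g hg => absurd (by rw [zero_mul, condExp_zero]) hg
  add_mem' := by
    intro b c hb hc g hg
    by_contra hgS
    refine hg ?_
    have h1 : condExp α π (b * groupUnitary α π g⁻¹) = 0 := not_not.1 fun h => hgS (hb h)
    have h2 : condExp α π (c * groupUnitary α π g⁻¹) = 0 := not_not.1 fun h => hgS (hc h)
    apply π.injective
    rw [add_mul, hom_condExp]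
    have h1' := hom_condExp α π (b * groupUnitary α π g⁻¹)
    have h2' := hom_condExp α π (c * groupUnitary α π g⁻¹)
    rw [h1, map_zero] at h1'
    rw [h2, map_zero] at h2'
    have : ∀ S T : L2 Γ H →L[ℂ] L2 Γ H, compress (S + T) = compress S + compress T := by
      intro S T; simp [compress]
    rw [AddMemClass.coe_add, this, ← h1', ← h2', add_zero, map_zero]
  smul_mem' := by
    intro c b hb g hg
    refine hb fun h => hg ?_
    -- Scalars act on the crossed product through `A`, and `E` is left `A`-linear.
    have hc : c • b * groupUnitary α π g⁻¹ =
        ofCoeff α π (algebraMap ℂ A c) * (b * groupUnitary α π g⁻¹) := by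
      rw [Algebra.algebraMap_eq_smul_one, smul_mul_assoc]
      refine Subtype.ext ?_
      change c • _ = coeffOp α π (c • 1) * _
      rw [coeffOp_smul, coeffOp_one, smul_mul_assoc, one_mul]
    rw [hc, condExp_ofCoeff_mul, h, mul_zero]

lemma mem_suppBimodule {S : Set Γ} {b : crossedProduct α π} :
    b ∈ suppBimodule α π S ↔ supp α π b ⊆ S := Iff.rfl

lemma suppSubspace_suppBimodule [Nontrivial A] (S : Set Γ) :
    suppSubspace α π (suppBimodule α π S) = S := by
  refine Set.Subset.antisymm (Set.iUnion₂_subset fun _ hb => hb) fun g hg => ?_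
  refine Set.mem_iUnion₂.2 ⟨groupUnitary α π g, ?_, ?_⟩
  · rw [mem_suppBimodule, supp_groupUnitary]
    exact Set.singleton_subset_iff.2 hg
  · rw [supp_groupUnitary]
    exact Set.mem_singleton g

lemma isRepleteBimodule_suppBimodule [Nontrivial A] (S : Set Γ) :
    IsRepleteBimodule α π (suppBimodule α π S) where
  left_mem := fun a _ hx g hg => hx fun h => hg <| by
    rw [mul_assoc, condExp_ofCoeff_mul, h, mul_zero]
  right_mem := fun a _ hx g hg => hx fun h => hg <| by
    rw [mul_assoc, ofCoeff_mul_groupUnitary, ← mul_assoc, condExp_mul_ofCoeff, h, zero_mul]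
  isClosed := by
    have : (suppBimodule α π S : Set (crossedProduct α π)) =
        ⋂ g ∈ Sᶜ, {b | condExp α π (b * groupUnitary α π g⁻¹) = 0} := by
      ext b
      simp only [SetLike.mem_coe, mem_suppBimodule, Set.mem_iInter, Set.mem_ofPred_eq]
      exact forall_congr' fun g => not_imp_comm
    rw [this]
    exact isClosed_biInter fun g _ => isClosed_eq
      ((continuous_condExp α π).comp (continuous_mul_const _)) continuous_const
  replete := fun _ hy => by
    rwa [suppSubspace_suppBimodule] at hy

lemma IsRepleteBimodule.eq_suppBimodule {X : Submodule ℂ (crossedProduct α π)}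
    (hX : IsRepleteBimodule α π X) : X = suppBimodule α π (suppSubspace α π X) :=
  le_antisymm (fun _ hx => Set.subset_biUnion_of_mem (u := fun x => supp α π x) hx)
    fun y hy => hX.replete y hy

/-! ### Generation of the correspondence by the group unitaries -/

/-- The vector `u_g Ω` of `ℬ`. -/
def unitVec (g : Γ) : Corr α π := toCorr α π (groupUnitary α π g)

lemma lact_unitVec (a : A) (g : Γ) :
    lact α π a (unitVec α π g) = toCorr α π (ofCoeff α π a * groupUnitary α π g) := rfl

lemma lact_unitVec_eq_ract (a : A) (g : Γ) :
    lact α π a (unitVec α π g) = ract α π (unitVec α π g) (α g⁻¹ a) := by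
  rw [lact_unitVec, unitVec, ract_toCorr, ofCoeff_mul_groupUnitary]

lemma corrInner_unitVec_self (g : Γ) : corrInner α π (unitVec α π g) (unitVec α π g) = 1 := by
  rw [unitVec, corrInner_toCorr, star_groupUnitary, ← groupUnitary_mul, inv_mul_cancel,
    groupUnitary_one, ← ofCoeff_one, condExp_ofCoeff]

lemma unitVec_ne_zero [Nontrivial A] (g : Γ) : unitVec α π g ≠ 0 := fun h => by
  have h1 := norm_sq_corr α π (unitVec α π g)
  rw [corrInner_unitVec_self, (norm_eq_zero (a := unitVec α π g)).2 h, norm_one] at h1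
  norm_num at h1

/-- A closed subspace of `ℬ` containing all vectors `a u_g Ω` is everything. -/
lemma mem_of_isClosed_of_lact_unitVec_mem (K : Submodule ℂ (Corr α π))
    (hK : IsClosed (K : Set (Corr α π))) (h : ∀ a g, lact α π a (unitVec α π g) ∈ K)
    (ξ : Corr α π) : ξ ∈ K := by
  have hc : IsClosed ((K.map (preCorr α π).topologicalClosure.subtype : Submodule ℂ _) :
      Set (H →L[ℂ] L2 Γ H)) := by
    rw [Submodule.map_coe]
    exact (preCorr α π).isClosed_topologicalClosure.isClosedEmbedding_subtypeVal.isClosedMap _ hK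
  have hmem : (ξ : H →L[ℂ] L2 Γ H) ∈ K.map (preCorr α π).topologicalClosure.subtype := by
    refine Corr.induction α π (P := fun T => T ∈ K.map (preCorr α π).topologicalClosure.subtype)
      hc (fun b => ?_) ξ
    refine crossedProduct_induction α π
      (P := fun T => T ∘L inclOne Γ H ∈ K.map (preCorr α π).topologicalClosure.subtype)
      (hc.preimage (f := fun T : L2 Γ H →L[ℂ] L2 Γ H => T ∘L inclOne Γ H) (by fun_prop))
      ?_ (fun S T hS hT => ?_) (fun c T hT => ?_) (fun a g => ⟨_, h a g, rfl⟩) b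
    · rw [ContinuousLinearMap.zero_comp]
      exact zero_mem _
    · rw [ContinuousLinearMap.add_comp]
      exact add_mem hS hT
    · rw [ContinuousLinearMap.smul_comp]
      exact Submodule.smul_mem _ c hT
  obtain ⟨η, hη, h'⟩ := hmem
  exact (Subtype.ext h' : η = ξ) ▸ hη

lemma continuous_corrInner_left (η : Corr α π) : Continuous fun ξ => corrInner α π ξ η := by
  rw [(NonUnitalStarAlgHom.isometry π.hom π.injective).isEmbedding.continuous_iff]
  refine Continuous.congr (f := fun ξ : Corr α π => (ξ : H →L[ℂ] L2 Γ H).adjoint ∘L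
    (η : H →L[ℂ] L2 Γ H)) ?_ fun ξ => (hom_corrInner α π ξ η).symm
  exact ((ContinuousLinearMap.adjoint.continuous).comp continuous_subtype_val).clm_comp
    continuous_const

lemma corrInner_zero_right (ξ : Corr α π) : corrInner α π ξ 0 = 0 := by
  simpa using corrInner_smul_right α π 0 ξ 0

lemma corrInner_zero_left (ξ : Corr α π) : corrInner α π 0 ξ = 0 := by
  rw [← corrInner_star, corrInner_zero_right, star_zero]

lemma corrInner_ract_left (ξ η : Corr α π) (a : A) :
    corrInner α π (ract α π ξ a) η = star a * corrInner α π ξ η := by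
  rw [← corrInner_star, corrInner_ract, star_mul, corrInner_star]

/-- A vector of `ℬ` is determined by its coordinates `⟨u_g Ω | ξ⟩`. -/
lemma eq_zero_of_forall_corrInner_unitVec {ξ : Corr α π}
    (h : ∀ g, corrInner α π (unitVec α π g) ξ = 0) : ξ = 0 := by
  refine corr_ext α π fun η => ?_
  rw [corrInner_zero_right]
  let K : Submodule ℂ (Corr α π) :=
    { carrier := {η | corrInner α π η ξ = 0}
      zero_mem' := corrInner_zero_left α π ξ
      add_mem' := fun {η ζ} hη hζ => by
        simp only [Set.mem_ofPred_eq] at hη hζ ⊢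
        rw [← corrInner_star, corrInner_add_right, star_add, corrInner_star, corrInner_star, hη,
          hζ, add_zero]
      smul_mem' := fun c η hη => by
        simp only [Set.mem_ofPred_eq] at hη ⊢
        rw [← corrInner_star, corrInner_smul_right, star_smul, corrInner_star, hη, smul_zero] }
  refine mem_of_isClosed_of_lact_unitVec_mem α π K
    (isClosed_eq (continuous_corrInner_left α π ξ) continuous_const) (fun a g => ?_) η
  change corrInner α π _ ξ = 0
  rw [lact_unitVec_eq_ract, corrInner_ract_left, h, mul_zero]

lemma corrInner_unitVec_of_ne {g h : Γ} (hgh : h ≠ g) :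
    corrInner α π (unitVec α π h) (unitVec α π g) = 0 := by
  have hne : h⁻¹ * g ≠ 1 := fun h1 => hgh (inv_mul_eq_one.1 h1)
  have := condExp_ofCoeff_mul_groupUnitary α π 1 hne
  rw [ofCoeff_one, one_mul] at this
  rw [unitVec, unitVec, corrInner_toCorr, star_groupUnitary, ← groupUnitary_mul, this]

/-! ### Intertwining vectors -/

variable {α π}

/-- Outerness enters here: a vector `ξ` of `ℬ` with `a ▷ ξ = ξ ◁ α_{g⁻¹}(a)` has coordinates `c_h`
with `α_{h⁻¹}(a) c_h = c_h α_{g⁻¹}(a)`, so that `c_h = 0` for `h ≠ g` and `c_g` is central. -/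
lemma exists_eq_smul_unitVec (hA : IsSimpleCStar A) (hα : IsOuter α) {g : Γ} {ξ : Corr α π}
    (hξ : ∀ a, lact α π a ξ = ract α π ξ (α g⁻¹ a)) : ∃ c : ℂ, ξ = c • unitVec α π g := by
  have key : ∀ h a, α h⁻¹ a * corrInner α π (unitVec α π h) ξ =
      corrInner α π (unitVec α π h) ξ * α g⁻¹ a := fun h a => by
    rw [← corrInner_ract, ← hξ, ← star_star a, ← corrInner_lact, lact_unitVec_eq_ract,
      corrInner_ract_left, map_star]
  have hoff : ∀ h, h ≠ g → corrInner α π (unitVec α π h) ξ = 0 := fun h hne => by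
    by_contra hc
    obtain ⟨u, hu⟩ := hA.exists_unitary_of_intertwine (α (h⁻¹ * g)) hc fun a => by
      have := key h (α g a)
      rwa [← StarAlgEquiv.mul_apply, ← StarAlgEquiv.mul_apply, ← map_mul, ← map_mul,
        inv_mul_cancel, map_one, StarAlgEquiv.one_apply] at this
    exact hα _ (fun h1 => hne (inv_mul_eq_one.1 h1)) u hu
  obtain ⟨c, hc⟩ := hA.exists_eq_algebraMap (z := corrInner α π (unitVec α π g) ξ) fun a => by
    have := key g (α g a)
    rwa [← StarAlgEquiv.mul_apply, ← map_mul, inv_mul_cancel, map_one,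
      StarAlgEquiv.one_apply] at this
  refine ⟨c, sub_eq_zero.1 (eq_zero_of_forall_corrInner_unitVec α π fun h => ?_)⟩
  rw [corrInner_sub_right, corrInner_smul_right]
  by_cases hgh : h = g
  · subst hgh
    rw [hc, corrInner_unitVec_self, Algebra.algebraMap_eq_smul_one, sub_self]
  · rw [hoff h hgh, corrInner_unitVec_of_ne α π hgh, smul_zero, sub_zero]

variable (α π)

/-! ### Diagonal operators -/

variable (H) in
/-- The multiplication operator `(M_f ξ)(g) = f(g) ξ(g)` on `ℓ²(Γ, H)`. -/
def mulOp (f : LInfty Γ) : L2 Γ H →L[ℂ] L2 Γ H :=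
  diagOp (fun g => f g • (1 : H →L[ℂ] H)) ‖f‖ (norm_nonneg f) fun g => by
    rw [norm_smul]
    exact (mul_le_of_le_one_right (norm_nonneg _) ContinuousLinearMap.norm_id_le).trans
      (lp.norm_apply_le_norm ENNReal.top_ne_zero f g)

@[simp] lemma mulOp_apply (f : LInfty Γ) (ξ : L2 Γ H) (g : Γ) : mulOp H f ξ g = f g • ξ g := rfl

lemma adjoint_mulOp (f : LInfty Γ) : (mulOp H f).adjoint = mulOp H (star f) := by
  rw [eq_comm, ContinuousLinearMap.eq_adjoint_iff]
  intro ξ η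
  rw [lp.inner_eq_tsum, lp.inner_eq_tsum]
  congr 1
  funext g
  simp [inner_smul_left, inner_smul_right]

lemma mulOp_comp_monomial (f : LInfty Γ) (a : A) (g : Γ) :
    mulOp H f ∘L (coeffOp α π a * transOp H g) ∘L inclOne Γ H =
      f g • (coeffOp α π a * transOp H g) ∘L inclOne Γ H := by
  ext x h
  by_cases hg : h = g
  · subst hg
    simp
  · have hne : g⁻¹ * h ≠ 1 := fun h1 => hg (inv_mul_eq_one.1 h1).symm
    simp [inclOne_apply_ne _ hne]

lemma mulOp_comp_mem (f : LInfty Γ) (ξ : Corr α π) :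
    mulOp H f ∘L (ξ : H →L[ℂ] L2 Γ H) ∈ (preCorr α π).topologicalClosure := by
  let K : Submodule ℂ (Corr α π) := ((preCorr α π).topologicalClosure.comap
    (ContinuousLinearMap.compL ℂ H (L2 Γ H) (L2 Γ H) (mulOp H f)).toLinearMap).comap
      (preCorr α π).topologicalClosure.subtype
  refine mem_of_isClosed_of_lact_unitVec_mem α π K ?_ (fun a g => ?_) ξ
  · exact (preCorr α π).isClosed_topologicalClosure.preimage
      (f := fun ξ : Corr α π => mulOp H f ∘L (ξ : H →L[ℂ] L2 Γ H)) (by fun_prop)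
  · change mulOp H f ∘L (coeffOp α π a * transOp H g) ∘L inclOne Γ H ∈
      (preCorr α π).topologicalClosure
    rw [mulOp_comp_monomial]
    exact Submodule.smul_mem _ _ (lact α π a (unitVec α π g)).2

/-- The diagonal endomorphism of `ℬ` that multiplies `a u_g Ω` by `f g`. -/
def diagEnd (f : LInfty Γ) : Corr α π →L[ℂ] Corr α π where
  toFun ξ := ⟨mulOp H f ∘L (ξ : H →L[ℂ] L2 Γ H), mulOp_comp_mem α π f ξ⟩
  map_add' ξ η := Subtype.ext (ContinuousLinearMap.comp_add _ _ _)
  map_smul' c ξ := Subtype.ext (ContinuousLinearMap.comp_smul _ _ _)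
  cont := Continuous.subtype_mk (by fun_prop) _

lemma diagEnd_lact_unitVec (f : LInfty Γ) (a : A) (g : Γ) :
    diagEnd α π f (lact α π a (unitVec α π g)) = f g • lact α π a (unitVec α π g) :=
  Subtype.ext (mulOp_comp_monomial α π f a g)

lemma lact_one (ξ : Corr α π) : lact α π 1 ξ = ξ := by
  apply Subtype.ext
  change coeffOp α π 1 ∘L _ = _
  rw [coeffOp_one]
  rfl

lemma diagEnd_unitVec (f : LInfty Γ) (g : Γ) :
    diagEnd α π f (unitVec α π g) = f g • unitVec α π g := by
  rw [← lact_one α π (unitVec α π g), diagEnd_lact_unitVec]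

lemma isAdjointPair_diagEnd (f : LInfty Γ) :
    IsAdjointPair α π (diagEnd α π f) (diagEnd α π (star f)) := fun ξ η => by
  apply π.injective
  rw [hom_corrInner, hom_corrInner]
  change (mulOp H f ∘L (ξ : H →L[ℂ] L2 Γ H)).adjoint ∘L (η : H →L[ℂ] L2 Γ H) =
    (ξ : H →L[ℂ] L2 Γ H).adjoint ∘L (mulOp H (star f) ∘L (η : H →L[ℂ] L2 Γ H))
  rw [ContinuousLinearMap.adjoint_comp, adjoint_mulOp]
  rfl

lemma diagEnd_mem (f : LInfty Γ) : diagEnd α π f ∈ EndAA α π := by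
  refine ⟨fun a ξ => Subtype.ext ?_, fun ξ a => rfl, _, isAdjointPair_diagEnd α π f⟩
  change mulOp H f ∘L coeffOp α π a ∘L (ξ : H →L[ℂ] L2 Γ H) =
    coeffOp α π a ∘L mulOp H f ∘L (ξ : H →L[ℂ] L2 Γ H)
  ext x g
  simp

/-- Bounded operators on `ℬ` that commute with the left action are determined by their values on
the vectors `u_g Ω`. -/
lemma eq_of_unitVec {T S : Corr α π →L[ℂ] Corr α π}
    (hT : ∀ a ξ, T (lact α π a ξ) = lact α π a (T ξ))
    (hS : ∀ a ξ, S (lact α π a ξ) = lact α π a (S ξ))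
    (h : ∀ g, T (unitVec α π g) = S (unitVec α π g)) : T = S := by
  ext1 ξ
  refine mem_of_isClosed_of_lact_unitVec_mem α π (LinearMap.eqLocus T.toLinearMap S.toLinearMap)
    (isClosed_eq T.continuous S.continuous) (fun a g => ?_) ξ
  change T _ = S _
  rw [hT, hS, h]

lemma star_eq_of_isAdjointPair {T S : EndAA α π}
    (h : IsAdjointPair α π (T : Corr α π →L[ℂ] Corr α π) S) : star T = S := by
  refine Subtype.ext (ContinuousLinearMap.ext fun η => corr_ext α π fun ξ => ?_)
  rw [← isAdjointPair_star α π T, h]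

/-- The diagonal endomorphism `diagEnd f` as an element of `End†(_Aℬ_A)`. -/
def diagElem (f : LInfty Γ) : EndAA α π := ⟨diagEnd α π f, diagEnd_mem α π f⟩

lemma diagElem_mul (f h : LInfty Γ) :
    diagElem α π (f * h) = diagElem α π f * diagElem α π h := by
  apply Subtype.ext
  ext ξ x g
  exact mul_smul (f g) (h g) ((ξ : H →L[ℂ] L2 Γ H) x g)

lemma diagElem_add (f h : LInfty Γ) :
    diagElem α π (f + h) = diagElem α π f + diagElem α π h := by
  apply Subtype.ext
  ext ξ x g
  exact add_smul (f g) (h g) ((ξ : H →L[ℂ] L2 Γ H) x g)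

lemma diagElem_smul (c : ℂ) (f : LInfty Γ) : diagElem α π (c • f) = c • diagElem α π f := by
  apply Subtype.ext
  ext ξ x g
  exact mul_smul c (f g) ((ξ : H →L[ℂ] L2 Γ H) x g)

lemma diagElem_star (f : LInfty Γ) : diagElem α π (star f) = star (diagElem α π f) := by
  symm
  apply star_eq_of_isAdjointPair
  exact isAdjointPair_diagEnd α π f

variable {α π}

lemma norm_smul_unitVec [Nontrivial A] (c : ℂ) (g : Γ) :
    ‖((c • unitVec α π g : Corr α π) : H →L[ℂ] L2 Γ H)‖ = ‖c‖ := by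
  have h := norm_sq_corr α π (c • unitVec α π g)
  rw [corrInner_smul_right, ← corrInner_star, corrInner_smul_right, corrInner_unitVec_self,
    star_smul, star_one, norm_smul (β := A), norm_smul (β := A), norm_star, norm_one,
    mul_one, ← pow_two] at h
  exact (pow_left_inj₀ (norm_nonneg _) (norm_nonneg _) two_ne_zero).1 h

/-- The eigenvalues of a continuous operator on the unit vectors `u_g Ω` are bounded. -/
lemma exists_bound_of_unitVec [Nontrivial A] (T : Corr α π →L[ℂ] Corr α π) {f : Γ → ℂ}
    (hf : ∀ g, T (unitVec α π g) = f g • unitVec α π g) : ∃ C, ∀ g, ‖f g‖ ≤ C := by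
  have hcont : Continuous fun ξ : Corr α π => (T ξ : H →L[ℂ] L2 Γ H) :=
    continuous_subtype_val.comp T.continuous
  have h0 := hcont.continuousAt.preimage_mem_nhds (x := 0)
    (by rw [map_zero]; exact Metric.ball_mem_nhds (α := H →L[ℂ] L2 Γ H) _ one_pos)
  rw [nhds_subtype_eq_comap, Filter.mem_comap] at h0
  obtain ⟨V, hV, hVT⟩ := h0
  obtain ⟨ε, hε, hball⟩ := (Metric.mem_nhds_iff (α := H →L[ℂ] L2 Γ H)).1 hV
  refine ⟨2 / ε, fun g => ?_⟩
  have hmem : (((ε / 2 : ℝ) : ℂ) • unitVec α π g : Corr α π) ∈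
      (fun ξ : Corr α π => (T ξ : H →L[ℂ] L2 Γ H)) ⁻¹'
      Metric.ball ((0 : Corr α π) : H →L[ℂ] L2 Γ H) 1 := by
    refine hVT (hball ?_)
    rw [ZeroMemClass.coe_zero, mem_ball_zero_iff (E := H →L[ℂ] L2 Γ H), norm_smul_unitVec,
      Complex.norm_real, Real.norm_of_nonneg (by positivity)]
    linarith
  rw [Set.mem_preimage, ZeroMemClass.coe_zero, mem_ball_zero_iff (E := H →L[ℂ] L2 Γ H), map_smul, hf,
    smul_smul, norm_smul_unitVec,
    norm_mul, Complex.norm_real, Real.norm_of_nonneg (by positivity)] at hmem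
  rw [le_div_iff₀ hε]
  linarith

/-- Every element of `End†(_Aℬ_A)` is diagonal: it preserves intertwining vectors, hence maps each
`u_g Ω` to a multiple of itself. -/
lemma exists_diagEnd_eq (hA : IsSimpleCStar A) (hα : IsOuter α) (T : EndAA α π) :
    ∃ f : LInfty Γ, diagEnd α π f = T := by
  have := hA.1
  obtain ⟨T, hT⟩ := T
  have hex : ∀ g, ∃ c : ℂ, T (unitVec α π g) = c • unitVec α π g := fun g =>
    exists_eq_smul_unitVec hA hα fun a => by
      rw [← hT.1, lact_unitVec_eq_ract, hT.2.1]
  choose f hf using hex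
  obtain ⟨C, hC⟩ := exists_bound_of_unitVec T hf
  refine ⟨⟨f, memℓp_infty ⟨C, by rintro _ ⟨g, rfl⟩; exact hC g⟩⟩, ?_⟩
  refine eq_of_unitVec α π (diagEnd_mem α π _).1 hT.1 fun g => ?_
  rw [diagEnd_unitVec, hf]

lemma diagElem_injective (hA : IsSimpleCStar A) :
    Function.Injective (diagElem α π) := by
  intro f h hfh
  have := hA.1
  refine lp.ext (funext fun g => ?_)
  have h1 : diagEnd α π f (unitVec α π g) = diagEnd α π h (unitVec α π g) :=
    congrArg (fun T : EndAA α π => (T : Corr α π →L[ℂ] Corr α π) (unitVec α π g)) hfh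
  rw [diagEnd_unitVec, diagEnd_unitVec] at h1
  exact smul_left_injective ℂ (unitVec_ne_zero α π g) h1

/-- The *-isomorphism `ℓ^∞(Γ) ≃ End†(_Aℬ_A)`. -/
def diagEquiv (hA : IsSimpleCStar A) (hα : IsOuter α) : LInfty Γ ≃⋆ₐ[ℂ] EndAA α π where
  toEquiv := Equiv.ofBijective (diagElem α π) ⟨diagElem_injective hA,
    fun T => (exists_diagEnd_eq hA hα T).imp fun _ hf => Subtype.ext hf⟩
  map_mul' := diagElem_mul α π
  map_add' := diagElem_add α π
  map_star' := diagElem_star α π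
  map_smul' := diagElem_smul α π

lemma coe_diagEquiv (hA : IsSimpleCStar A) (hα : IsOuter α) (f : LInfty Γ) :
    (diagEquiv (π := π) hA hα f : Corr α π →L[ℂ] Corr α π) = diagEnd α π f := rfl

/-! ### Complemented subcorrespondences and subsets of the group -/

variable (α π)

/-- The subcorrespondence of all vectors of `ℬ` whose coordinates vanish outside `S`. -/
def suppCorr (S : Set Γ) : Submodule ℂ (Corr α π) :=
  LinearMap.range (diagEnd α π (indicatorFn S)).toLinearMap

lemma indicatorFn_of_mem {S : Set Γ} {g : Γ} (hg : g ∈ S) : indicatorFn S g = 1 :=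
  Set.indicator_of_mem hg 1

lemma indicatorFn_of_notMem {S : Set Γ} {g : Γ} (hg : g ∉ S) : indicatorFn S g = 0 :=
  Set.indicator_of_notMem hg 1

lemma diagEnd_indicatorFn_idem (S : Set Γ) (ξ : Corr α π) :
    diagEnd α π (indicatorFn S) (diagEnd α π (indicatorFn S) ξ) =
      diagEnd α π (indicatorFn S) ξ := by
  ext x g
  change indicatorFn S g • indicatorFn S g • (_ : H) = indicatorFn S g • _
  by_cases hg : g ∈ S
  · rw [indicatorFn_of_mem hg, one_smul]
  · rw [indicatorFn_of_notMem hg, zero_smul, zero_smul]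

lemma star_indicatorFn (S : Set Γ) : star (indicatorFn S) = indicatorFn S := by
  ext g
  rw [lp.star_apply]
  by_cases hg : g ∈ S
  · rw [indicatorFn_of_mem hg, star_one]
  · rw [indicatorFn_of_notMem hg, star_zero]

lemma mem_suppCorr_iff {S : Set Γ} {ξ : Corr α π} :
    ξ ∈ suppCorr α π S ↔ diagEnd α π (indicatorFn S) ξ = ξ := by
  refine ⟨?_, fun h => ⟨ξ, h⟩⟩
  rintro ⟨η, rfl⟩
  exact diagEnd_indicatorFn_idem α π S η

lemma unitVec_mem_suppCorr_iff [Nontrivial A] {S : Set Γ} {g : Γ} :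
    unitVec α π g ∈ suppCorr α π S ↔ g ∈ S := by
  rw [mem_suppCorr_iff, diagEnd_unitVec]
  by_cases hg : g ∈ S
  · simp [indicatorFn_of_mem hg, hg]
  · simp [indicatorFn_of_notMem hg, hg, (unitVec_ne_zero α π g).symm]

lemma isComplementedSubcorr_suppCorr (S : Set Γ) : IsComplementedSubcorr α π (suppCorr α π S) where
  left_mem := fun a ξ hξ => by
    rw [mem_suppCorr_iff] at hξ ⊢
    rw [(diagEnd_mem α π _).1, hξ]
  right_mem := fun a ξ hξ => by
    rw [mem_suppCorr_iff] at hξ ⊢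
    rw [(diagEnd_mem α π _).2.1, hξ]
  isClosed := by
    have : (suppCorr α π S : Set (Corr α π)) = {ξ | diagEnd α π (indicatorFn S) ξ = ξ} :=
      Set.ext fun ξ => mem_suppCorr_iff α π
    rw [this]
    exact isClosed_eq (diagEnd α π _).continuous continuous_id
  decomp := fun ξ => by
    refine ⟨_, ⟨ξ, rfl⟩, ξ - diagEnd α π (indicatorFn S) ξ, ?_, (add_sub_cancel _ _).symm⟩
    rintro _ ⟨η, rfl⟩
    have h := isAdjointPair_diagEnd α π (indicatorFn S)
    rw [star_indicatorFn] at h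
    refine (h _ _).trans ?_
    rw [map_sub, diagEnd_indicatorFn_idem, sub_self, corrInner_zero_right]

variable {α π}

lemma eq_zero_of_mem_of_mem_orthCompl {L : Submodule ℂ (Corr α π)}
    {ξ : Corr α π} (h : ξ ∈ L) (h' : ξ ∈ orthCompl α π L) : ξ = 0 := by
  have := norm_sq_corr α π ξ
  rwa [h' ξ h, norm_zero, sq_eq_zero_iff, norm_eq_zero (a := ξ)] at this

lemma lact_mem_orthCompl {L : Submodule ℂ (Corr α π)} (hL : IsComplementedSubcorr α π L) (a : A)
    {ζ : Corr α π} (hζ : ζ ∈ orthCompl α π L) : lact α π a ζ ∈ orthCompl α π L := fun ξ hξ => by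
  rw [← star_star a, ← corrInner_lact]
  exact hζ _ (hL.left_mem _ ξ hξ)

lemma ract_mem_orthCompl {L : Submodule ℂ (Corr α π)} (a : A)
    {ζ : Corr α π} (hζ : ζ ∈ orthCompl α π L) : ract α π ζ a ∈ orthCompl α π L := fun ξ hξ => by
  rw [corrInner_ract, hζ ξ hξ, zero_mul]

/-- The components of `u_g Ω` in `L` and in `L^⊥` are intertwining vectors, hence multiples of
`u_g Ω`; being orthogonal, one of them vanishes. -/
lemma IsComplementedSubcorr.unitVec_mem_or (hA : IsSimpleCStar A) (hα : IsOuter α)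
    {L : Submodule ℂ (Corr α π)} (hL : IsComplementedSubcorr α π L) (g : Γ) :
    unitVec α π g ∈ L ∨ unitVec α π g ∈ orthCompl α π L := by
  obtain ⟨η, hη, ζ, hζ, hsum⟩ := hL.decomp (unitVec α π g)
  obtain ⟨c, hc⟩ := exists_eq_smul_unitVec hA hα (g := g) (ξ := η) fun a => by
    -- The defect of `η` lies in `L` and is the negative of the defect of `ζ`, which lies in `L^⊥`.
    have h1 : lact α π a η - ract α π η (α g⁻¹ a) = ract α π ζ (α g⁻¹ a) - lact α π a ζ := by
      have := lact_unitVec_eq_ract α π a g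
      rw [hsum, lact_add, ract_add] at this
      rw [sub_eq_sub_iff_add_eq_add, this, add_comm]
    refine sub_eq_zero.1 (eq_zero_of_mem_of_mem_orthCompl
      (L.sub_mem (hL.left_mem a η hη) (hL.right_mem _ η hη)) ?_)
    rw [h1]
    intro ξ hξ
    rw [corrInner_sub_right, ract_mem_orthCompl _ hζ ξ hξ, lact_mem_orthCompl hL a hζ ξ hξ,
      sub_zero]
  by_cases hc0 : c = 0
  · right
    rw [hsum, hc, hc0, zero_smul, zero_add]
    exact hζ
  · left
    have : unitVec α π g = c⁻¹ • η := by rw [hc, inv_smul_smul₀ hc0]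
    rw [this]
    exact L.smul_mem _ hη

lemma IsComplementedSubcorr.suppCorr_le {L : Submodule ℂ (Corr α π)}
    (hL : IsComplementedSubcorr α π L) {S : Set Γ} (hS : ∀ g ∈ S, unitVec α π g ∈ L) :
    suppCorr α π S ≤ L := by
  rintro _ ⟨ξ, rfl⟩
  refine mem_of_isClosed_of_lact_unitVec_mem α π
    (L.comap (diagEnd α π (indicatorFn S)).toLinearMap)
    (hL.isClosed.preimage (diagEnd α π _).continuous) (fun a g => ?_) ξ
  change diagEnd α π _ _ ∈ L
  rw [diagEnd_lact_unitVec]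
  by_cases hg : g ∈ S
  · exact L.smul_mem _ (hL.left_mem a _ (hS g hg))
  · rw [indicatorFn_of_notMem hg, zero_smul]
    exact L.zero_mem

/-- A complemented subcorrespondence consists of the vectors supported on those `g` for which it
contains `u_g Ω`. -/
lemma IsComplementedSubcorr.eq_suppCorr (hA : IsSimpleCStar A) (hα : IsOuter α)
    {L : Submodule ℂ (Corr α π)} (hL : IsComplementedSubcorr α π L) :
    L = suppCorr α π {g | unitVec α π g ∈ L} := by
  refine le_antisymm (fun ξ hξ => ?_) (hL.suppCorr_le fun g hg => hg)
  rw [mem_suppCorr_iff]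
  refine sub_eq_zero.1 (eq_zero_of_forall_corrInner_unitVec α π fun g => ?_)
  have h := isAdjointPair_diagEnd α π (indicatorFn {g | unitVec α π g ∈ L})
  rw [star_indicatorFn] at h
  rw [corrInner_sub_right, ← h, diagEnd_unitVec]
  by_cases hg : unitVec α π g ∈ L
  · rw [indicatorFn_of_mem (S := {g | unitVec α π g ∈ L}) hg, one_smul, sub_self]
  · have h0 := ((hL.unitVec_mem_or hA hα g).resolve_left hg) ξ hξ
    rw [indicatorFn_of_notMem (S := {g | unitVec α π g ∈ L}) hg, zero_smul, corrInner_zero_left,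
      ← corrInner_star, h0, star_zero, sub_zero]

lemma ract_one (ξ : Corr α π) : ract α π ξ 1 = ξ := by
  apply Subtype.ext
  change (ξ : H →L[ℂ] L2 Γ H) ∘L π.hom 1 = _
  rw [map_one]
  rfl

lemma ract_mul (ξ : Corr α π) (a b : A) : ract α π ξ (a * b) = ract α π (ract α π ξ a) b := by
  apply Subtype.ext
  change (ξ : H →L[ℂ] L2 Γ H) ∘L π.hom (a * b) = _
  rw [map_mul]
  rfl

lemma lact_ract (ξ : Corr α π) (a b : A) :
    lact α π a (ract α π ξ b) = ract α π (lact α π a ξ) b := rfl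

lemma ract_add_right (ξ : Corr α π) (a b : A) :
    ract α π ξ (a + b) = ract α π ξ a + ract α π ξ b := by
  apply Subtype.ext
  simp [ract]

lemma ract_smul_right (ξ : Corr α π) (c : ℂ) (a : A) :
    ract α π ξ (c • a) = c • ract α π ξ a := by
  apply Subtype.ext
  simp [ract]

/-- Bimodule maps `_gA → L` are of the form `x ↦ t ◁ x` with `t` an intertwining vector, and the
intertwining vectors are the multiples of `u_g Ω`. -/
lemma IsComplementedSubcorr.corrSupp_eq (hA : IsSimpleCStar A) (hα : IsOuter α)
    {L : Submodule ℂ (Corr α π)} (hL : IsComplementedSubcorr α π L) :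
    corrSupp α π L = {g | unitVec α π g ∈ L} := by
  have := hA.1
  ext g
  constructor
  · rintro ⟨T, hT0, hTL, hT⟩
    -- `T` is determined by `T 1`, which is an intertwining vector.
    have hr : ∀ c, T c = ract α π (T 1) c := fun c => by
      simpa [lact_one] using hT 1 1 c
    obtain ⟨c, hc⟩ := exists_eq_smul_unitVec hA hα (g := g) (ξ := T 1) fun a => by
      rw [← hr]
      simpa [ract_one] using (hT a 1 1).symm
    have hc0 : c ≠ 0 := by
      rintro rfl
      refine hT0 (LinearMap.ext fun x => ?_)
      rw [hr, hc, ract_smul, zero_smul, LinearMap.zero_apply]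
    have : unitVec α π g = c⁻¹ • T 1 := by rw [hc, inv_smul_smul₀ hc0]
    change unitVec α π g ∈ L
    rw [this]
    exact L.smul_mem _ (hTL 1)
  · intro hg
    refine ⟨{ toFun := fun x => ract α π (unitVec α π g) x
              map_add' := ract_add_right _
              map_smul' := ract_smul_right _ }, fun h0 => ?_,
      fun x => hL.right_mem x _ hg, fun a x c => ?_⟩
    · refine unitVec_ne_zero α π g ?_
      rw [← ract_one (unitVec α π g)]
      exact DFunLike.congr_fun h0 1
    · change ract α π _ _ = ract α π (lact α π a (ract α π _ x)) c
      rw [ract_mul, ract_mul, lact_ract, lact_unitVec_eq_ract]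

lemma corrSupp_suppCorr (hA : IsSimpleCStar A) (hα : IsOuter α) (S : Set Γ) :
    corrSupp α π (suppCorr α π S) = S := by
  have := hA.1
  rw [(isComplementedSubcorr_suppCorr α π S).corrSupp_eq hA hα]
  exact Set.ext fun g => unitVec_mem_suppCorr_iff α π

lemma IsComplementedSubcorr.suppCorr_corrSupp (hA : IsSimpleCStar A) (hα : IsOuter α)
    {L : Submodule ℂ (Corr α π)} (hL : IsComplementedSubcorr α π L) :
    suppCorr α π (corrSupp α π L) = L := by
  rw [hL.corrSupp_eq hA hα, ← hL.eq_suppCorr hA hα]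

/-- A bimodule isomorphism carries `u_g Ω` to a nonzero intertwining vector, that is, to a nonzero
multiple of `u_g Ω`. -/
lemma IsComplementedSubcorr.le_of_subcorrIso (hA : IsSimpleCStar A) (hα : IsOuter α)
    {L M : Submodule ℂ (Corr α π)} (hL : IsComplementedSubcorr α π L)
    (hM : IsComplementedSubcorr α π M) (h : SubcorrIso α π L M) : L ≤ M := by
  have := hA.1
  obtain ⟨U, -, hUl, hUr⟩ := h
  rw [hL.eq_suppCorr hA hα]
  refine hM.suppCorr_le fun g hg => ?_
  obtain ⟨c, hc⟩ := exists_eq_smul_unitVec hA hα (g := g)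
      (ξ := (U ⟨unitVec α π g, hg⟩ : Corr α π)) fun a => by
    rw [← hUl a ⟨_, hg⟩ ⟨_, hL.left_mem a _ hg⟩ rfl]
    exact hUr _ ⟨_, hg⟩ _ (lact_unitVec_eq_ract α π a g)
  have hc0 : c ≠ 0 := by
    rintro rfl
    rw [zero_smul, ZeroMemClass.coe_eq_zero, LinearEquiv.map_eq_zero_iff] at hc
    exact unitVec_ne_zero α π g (congrArg Subtype.val hc)
  have : unitVec α π g = c⁻¹ • (U ⟨unitVec α π g, hg⟩ : Corr α π) := by
    rw [hc, inv_smul_smul₀ hc0]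
  rw [this]
  exact M.smul_mem _ (U _).2

lemma IsComplementedSubcorr.subcorrIso_symm {L M : Submodule ℂ (Corr α π)}
    (hL : IsComplementedSubcorr α π L) (h : SubcorrIso α π L M) : SubcorrIso α π M L := by
  obtain ⟨U, hU, hUl, hUr⟩ := h
  refine ⟨U.symm, fun ξ η => ?_, fun a ξ η h => ?_, fun a ξ η h => ?_⟩
  · rw [← hU, U.apply_symm_apply, U.apply_symm_apply]
  · have h1 := hUl a (U.symm ξ) ⟨_, hL.left_mem a _ (U.symm ξ).2⟩ rfl
    rw [U.apply_symm_apply, ← h] at h1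
    rw [← Subtype.ext h1, U.symm_apply_apply]
  · have h1 := hUr a (U.symm ξ) ⟨_, hL.right_mem a _ (U.symm ξ).2⟩ rfl
    rw [U.apply_symm_apply, ← h] at h1
    rw [← Subtype.ext h1, U.symm_apply_apply]

end RedCrossed

end

open RedCrossed in
theorem mainTheorem6 {A Γ H : Type*} [CStarAlgebra A] [Group Γ] [Countable Γ]
    [NormedAddCommGroup H] [InnerProductSpace ℂ H] [CompleteSpace H]
    (hA : IsSimpleCStar A) (α : Γ →* (A ≃⋆ₐ[ℂ] A)) (hα : IsOuter α) (π : FaithfulRep A H) :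
    ∃ Φ : LInfty Γ ≃⋆ₐ[ℂ] EndAA α π,
      (∀ (f : LInfty Γ) (a : A) (g : Γ),
        (Φ f : Corr α π →L[ℂ] Corr α π) (toCorr α π (ofCoeff α π a * groupUnitary α π g)) =
          f g • toCorr α π (ofCoeff α π a * groupUnitary α π g)) ∧
      (∃ e : {X : Submodule ℂ (crossedProduct α π) // IsRepleteBimodule α π X} ≃
          {L : Submodule ℂ (Corr α π) // IsComplementedSubcorr α π L},
        (∀ X, ((e X).1 : Set (Corr α π)) =
          Set.range (Φ (indicatorFn (suppSubspace α π X.1)) : Corr α π →L[ℂ] Corr α π)) ∧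
        (∀ L, ((e.symm L).1 : Set (crossedProduct α π)) =
          {b | supp α π b ⊆ corrSupp α π L.1})) ∧
      (∀ L M : Submodule ℂ (Corr α π), IsComplementedSubcorr α π L →
        IsComplementedSubcorr α π M → SubcorrIso α π L M → L = M) := by
  have := hA.1
  refine ⟨diagEquiv hA hα, diagEnd_lact_unitVec α π, ⟨
    { toFun := fun X => ⟨suppCorr α π (suppSubspace α π X.1),
        isComplementedSubcorr_suppCorr α π _⟩
      invFun := fun L => ⟨suppBimodule α π (corrSupp α π L.1),
        isRepleteBimodule_suppBimodule α π _⟩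
      left_inv := fun X => Subtype.ext ?_
      right_inv := fun L => Subtype.ext ?_ }, fun X => ?_, fun L => rfl⟩,
    fun L M hL hM h => ?_⟩
  · change suppBimodule α π (corrSupp α π (suppCorr α π _)) = X.1
    rw [corrSupp_suppCorr hA hα, ← X.2.eq_suppBimodule]
  · change suppCorr α π (suppSubspace α π (suppBimodule α π _)) = L.1
    rw [suppSubspace_suppBimodule, L.2.suppCorr_corrSupp hA hα]
  · rw [coe_diagEquiv]
    exact LinearMap.coe_range _
  · exact le_antisymm (hL.le_of_subcorrIso hA hα hM h)
      (hM.le_of_subcorrIso hA hα hL (hL.subcorrIso_symm h))
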